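/- Let $(M,g)$ be a smooth Riemannian manifold of dimension $n$ (without boundary). A function $f:M\to\mathbb R$ of class $C^2$ is called a metric function if the length $|\operatorname{grad} f|$ of its gradient is constant on every connected component of every level set of $f$. A gradient line of $f$ is a trajectory of $\dot x=\operatorname{grad} f(x)$, that is, a curve $\gamma:J\to M$ on an open interval $J\subseteq\mathbb R$ with $\dot\gamma(t)=\operatorname{grad} f(\gamma(t))$ for all $t\in J$. Let $f:M\to\mathbb R$ be a metric function. Then every gradient line $\gamma:J\to M$ of $f$ is, up to parametrization, a geodesic of $(M,g)$: there are an open interval $J'\subseteq\mathbb R$, a $C^2$ bijection $\varphi:J\to J'$ with $\varphi'>0$, and a geodesic $c:J'\to M$ of the Levi-Civita connection of $g$ (that is, $\nabla_{\dot c}\dot c=0$; a constant curve counts as a geodesic, which concerns only gradient lines consisting of a single critical point of $f$) such that $\gamma=c\circ\varphi$. In particular, in the Euclidean case $M=\mathbb R^n$ with its standard metric, every gradient line of a metric function $f:\mathbb R^n\to\mathbb R$ that is not reduced to a point has curvature $|T'|/|\dot\gamma|$, $T=\dot\gamma/|\dot\gamma|$, equal to zero at each of its points. -/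

import Mathlib

universe u

open Set Bundle
open scoped Manifold ContDiff Bundle InnerProductSpace

-- So that the charted space structure on Euclidean space is found as `chartedSpaceSelf`, and not
-- wrapped in a definitionally equal instance for `TopCat.of`.
attribute [-instance] TopCat.of.chartedSpace TopCat.of.hasGroupoid

noncomputable section

/-- The tangent spaces of an `n`-dimensional Riemannian manifold are complete (they are
finite-dimensional). -/
instance tangentSpace_completeSpace {n : ℕ} {M : Type u} [TopologicalSpace M]
    [ChartedSpace (EuclideanSpace ℝ (Fin n)) M]
    [RiemannianBundle (fun x : M ↦ TangentSpace (𝓡 n) x)] (x : M) :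
    CompleteSpace (TangentSpace (𝓡 n) x) :=
  haveI : FiniteDimensional ℝ (TangentSpace (𝓡 n) x) :=
    inferInstanceAs (FiniteDimensional ℝ (EuclideanSpace ℝ (Fin n)))
  FiniteDimensional.complete ℝ (TangentSpace (𝓡 n) x)

section Manifold

variable (n : ℕ) {M : Type u} [TopologicalSpace M] [ChartedSpace (EuclideanSpace ℝ (Fin n)) M]
  [RiemannianBundle (fun x : M ↦ TangentSpace (𝓡 n) x)]

/-- The Riemannian gradient: the tangent vector `grad f x` with `⟪grad f x, v⟫ = df_x v`. -/
def riemannianGradient (f : M → ℝ) (x : M) : TangentSpace (𝓡 n) x :=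
  (InnerProductSpace.toDual ℝ (TangentSpace (𝓡 n) x)).symm (mvfderiv (𝓡 n) f x)

/-- A metric function: a function of class `C^2` whose gradient has constant length on each
connected component of each of its level sets. -/
structure IsMetricFunction (f : M → ℝ) : Prop where
  contMDiff : ContMDiff (𝓡 n) 𝓘(ℝ, ℝ) 2 f
  norm_gradient_eq : ∀ x y : M, y ∈ connectedComponentIn (f ⁻¹' {f x}) x →
    ‖riemannianGradient n f y‖ = ‖riemannianGradient n f x‖

/-- `γ` is a gradient line of `f` on the open interval `J`: `γ' = grad f (γ)` on `J`. -/
structure IsGradientLineOn (f : M → ℝ) (γ : ℝ → M) (J : Set ℝ) : Prop where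
  isOpen : IsOpen J
  ordConnected : J.OrdConnected
  isMIntegralCurveOn : IsMIntegralCurveOn (I := 𝓡 n) γ (riemannianGradient n f) J

/-- The coordinate vector field `∂_i` of the chart around `x₀`, at the point with coordinates
`y`. -/
def coordVector (x₀ : M) (i : Fin n) (y : EuclideanSpace ℝ (Fin n)) :
    TangentSpace (𝓡 n) ((extChartAt (𝓡 n) x₀).symm y) :=
  mfderiv (𝓡 n) (𝓡 n) (extChartAt (𝓡 n) x₀).symm y (EuclideanSpace.single i (1 : ℝ))

/-- The matrix `g_{ij} = ⟪∂_i, ∂_j⟫` of the metric in the chart around `x₀`. -/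
def metricMatrix (x₀ : M) (y : EuclideanSpace ℝ (Fin n)) : Matrix (Fin n) (Fin n) ℝ :=
  Matrix.of fun i j ↦ ⟪coordVector n x₀ i y, coordVector n x₀ j y⟫_ℝ

/-- The partial derivative `∂_l g_{ij}` in the chart around `x₀`. -/
def metricPartial (x₀ : M) (l i j : Fin n) (y : EuclideanSpace ℝ (Fin n)) : ℝ :=
  fderiv ℝ (fun z ↦ metricMatrix n x₀ z i j) y (EuclideanSpace.single l (1 : ℝ))

/-- The Christoffel symbols of the Levi-Civita connection in the chart around `x₀`,
`Γ^k_{ij} = 1/2 ∑_l g^{kl} (∂_i g_{jl} + ∂_j g_{il} - ∂_l g_{ij})`. -/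
def christoffel (x₀ : M) (k i j : Fin n) (y : EuclideanSpace ℝ (Fin n)) : ℝ :=
  (1 / 2 : ℝ) * ∑ l, (metricMatrix n x₀ y)⁻¹ k l *
    (metricPartial n x₀ i j l y + metricPartial n x₀ j i l y - metricPartial n x₀ l i j y)

/-- The coordinates of the point `c t` in the chart around `x₀`. -/
def coords (x₀ : M) (c : ℝ → M) (k : Fin n) (t : ℝ) : ℝ :=
  extChartAt (𝓡 n) x₀ (c t) k

/-- `c` is an (affinely parametrized) geodesic on the open interval `J`: it is of class `C^2` there
and satisfies `(c^k)'' + ∑_{i,j} Γ^k_{ij} (c^i)' (c^j)' = 0` in every chart. Constant curves are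
included. -/
structure IsGeodesicOn (c : ℝ → M) (J : Set ℝ) : Prop where
  isOpen : IsOpen J
  ordConnected : J.OrdConnected
  contMDiffOn : ContMDiffOn 𝓘(ℝ, ℝ) (𝓡 n) 2 c J
  geodesic_eq : ∀ x₀ : M, ∀ t ∈ J, c t ∈ (extChartAt (𝓡 n) x₀).source → ∀ k : Fin n,
    deriv (deriv (coords n x₀ c k)) t +
      ∑ i, ∑ j, christoffel n x₀ k i j (extChartAt (𝓡 n) x₀ (c t)) *
        deriv (coords n x₀ c i) t * deriv (coords n x₀ c j) t = 0

/-- The curve `γ` on the interval `J` is a geodesic line: after an orientation preserving `C^2`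
change of parameter `φ : J → J'` with nowhere vanishing derivative it is a geodesic `c` on the
open interval `J'`. -/
def IsGeodesicLineOn (γ : ℝ → M) (J : Set ℝ) : Prop :=
  ∃ (c : ℝ → M) (J' : Set ℝ) (φ : ℝ → ℝ), IsGeodesicOn n c J' ∧
    ContDiffOn ℝ 2 φ J ∧ (∀ t ∈ J, 0 < deriv φ t) ∧ BijOn φ J J' ∧ ∀ t ∈ J, γ t = c (φ t)

end Manifold

/-- The curvature `|dT/ds| = |T'(t)| / |γ'(t)|` of a curve in Euclidean space, where
`T = γ' / |γ'|` is the unit tangent vector (meaningful where `γ` is `C^2` and `γ' ≠ 0`). -/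
def euclideanCurvature {n : ℕ} (γ : ℝ → EuclideanSpace ℝ (Fin n)) (t : ℝ) : ℝ :=
  ‖deriv (fun s ↦ ‖deriv γ s‖⁻¹ • deriv γ s) t‖ / ‖deriv γ t‖

end

/-!
At a regular point the level set of `f` is locally connected, so `|grad f|⁻¹` is constant on it
near that point and, by Lagrange multipliers, `d(|grad f|⁻¹)` is a multiple of `df`. Hence the form
`|grad f|⁻¹ df` dual to the unit field `N = grad f / |grad f|` is closed. Integral curves of a unit
field with closed dual form are geodesics. By uniqueness for ordinary differential equations a
gradient line through a critical point is constant; any other one is an integral curve of `N` when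
parametrized by arc length.
-/

section LevelSets

open Filter Topology

variable {E : Type*} [NormedAddCommGroup E] [NormedSpace ℝ E] [CompleteSpace E]
  {F h : E → ℝ} {F' h' : StrongDual ℝ E} {a : E}

theorem exists_mem_nhds_isPreconnected_inter_level (hF : HasStrictFDerivAt F F' a) (hF' : F' ≠ 0)
    {U : Set E} (hU : U ∈ 𝓝 a) :
    ∃ V ∈ 𝓝 a, V ⊆ U ∧ IsPreconnected (V ∩ F ⁻¹' {F a}) := by
  have hsurj : F'.range = ⊤ := LinearMap.range_eq_top.2 <| LinearMap.surjective
    fun hzero ↦ hF' (ContinuousLinearMap.coe_injective hzero)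
  let e := hF.implicitToOpenPartialHomeomorph F F' hsurj
  have he (x : E) : (e x).1 = F x := hF.implicitToOpenPartialHomeomorph_fst hsurj x
  have ha : a ∈ e.source := hF.mem_implicitToOpenPartialHomeomorph_source hsurj
  have hmem : e.target ∩ e.symm ⁻¹' U ∈ 𝓝 (e a) :=
    inter_mem (e.open_target.mem_nhds (e.map_source ha)) (e.tendsto_symm ha hU)
  obtain ⟨δ, hδ, hball⟩ := Metric.mem_nhds_iff.1 hmem
  have htarget : Metric.ball (e a) δ ⊆ e.target := fun p hp ↦ (hball hp).1
  refine ⟨e.symm '' Metric.ball (e a) δ, ?_, image_subset_iff.2 fun p hp ↦ (hball hp).2, ?_⟩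
  · have := e.symm.image_mem_nhds (e.map_source ha) (Metric.ball_mem_nhds (e a) hδ)
    rwa [e.left_inv ha] at this
  have hlevel : e.symm '' Metric.ball (e a) δ ∩ F ⁻¹' {F a} =
      e.symm '' (Metric.ball (e a) δ ∩ {F a} ×ˢ univ) := by
    rw [← image_inter_preimage]
    refine congrArg (e.symm '' ·) (Set.ext fun p ↦ and_congr_right fun hp ↦ ?_)
    simp [← he (e.symm p), e.right_inv (htarget hp)]
  rw [hlevel]
  exact (((convex_ball _ _).inter ((convex_singleton _).prod convex_univ)).isPreconnected).image _
    (e.symm.continuousOn.mono fun p hp ↦ htarget hp.1)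

theorem exists_eq_smul_of_eventually_eq_on_level (hF : HasStrictFDerivAt F F' a) (hF' : F' ≠ 0)
    (hh : HasStrictFDerivAt h h' a) (hconst : ∀ᶠ y in 𝓝 a, F y = F a → h y = h a) :
    ∃ r : ℝ, h' = r • F' := by
  have hextr : IsLocalExtrOn h {y | F y = F a} a :=
    Or.inl (eventually_nhdsWithin_iff.2 (hconst.mono fun y hy hlevel ↦ (hy hlevel).ge))
  obtain ⟨α, β, hαβ, hsum⟩ := hextr.exists_multipliers_of_hasStrictFDerivAt_1d hF hh
  have hβ : β ≠ 0 := by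
    rintro rfl
    simp_all
  refine ⟨-(β⁻¹ * α), ?_⟩
  ext v
  have hv : α * F' v + β * h' v = 0 := congrArg (fun A : StrongDual ℝ E ↦ A v) hsum
  change h' v = -(β⁻¹ * α) * F' v
  field_simp
  linarith

end LevelSets

section IntegralCurves

open Filter Topology

variable {E : Type*} [NormedAddCommGroup E] [NormedSpace ℝ E] {X : E → E} {x : ℝ → E}

theorem hasDerivAt_coord {ι : Type*} [Fintype ι] {z : ℝ → EuclideanSpace ℝ ι}
    {z' : EuclideanSpace ℝ ι} {t : ℝ} (hz : HasDerivAt z z' t) (i : ι) :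
    HasDerivAt (fun s ↦ z s i) (z' i) t :=
  (EuclideanSpace.proj (𝕜 := ℝ) i).hasFDerivAt.comp_hasDerivAt t hz

theorem contDiffOn_succ_of_hasDerivAt {U : Set E} {V : Set ℝ} (hV : IsOpen V) {m : ℕ}
    (hX : ContDiffOn ℝ m X U) (hxU : MapsTo x V U) (hx : ∀ t ∈ V, HasDerivAt x (X (x t)) t) :
    ContDiffOn ℝ (m + 1) x V := by
  have hdiff : DifferentiableOn ℝ x V := fun t ht ↦
    (hx t ht).differentiableAt.differentiableWithinAt
  have hstep : ContDiffOn ℝ m x V := by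
    induction m with
    | zero => exact contDiffOn_zero.2 hdiff.continuousOn
    | succ m ih =>
      have hxm := ih (hX.of_le (by norm_cast; lia))
      rw [Nat.cast_succ, contDiffOn_succ_iff_deriv_of_isOpen hV]
      exact ⟨hdiff, by simp, ((hX.of_le (by norm_cast; lia)).comp hxm hxU).congr
        fun t ht ↦ (hx t ht).deriv⟩
  rw [contDiffOn_succ_iff_deriv_of_isOpen hV]
  exact ⟨hdiff, by simp, (hX.comp hstep hxU).congr fun t ht ↦ (hx t ht).deriv⟩

theorem eventually_eq_of_hasDerivAt_of_eq_zero {t₀ : ℝ} (hX : ContDiffAt ℝ 1 X (x t₀))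
    (hx : ∀ᶠ t in 𝓝 t₀, HasDerivAt x (X (x t)) t) (h0 : X (x t₀) = 0) :
    ∀ᶠ t in 𝓝 t₀, x t = x t₀ := by
  obtain ⟨K, s, hs, hLip⟩ := hX.exists_lipschitzOnWith
  refine ODE_solution_unique_of_eventually (v := fun _ ↦ X) (s := fun _ ↦ s)
    (Eventually.of_forall fun _ ↦ hLip) ?_ (Eventually.of_forall fun t ↦ ⟨?_, mem_of_mem_nhds hs⟩)
    rfl
  · exact hx.and (hx.self_of_nhds.continuousAt hs)
  · simpa only [h0] using hasDerivAt_const t (x t₀)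

end IntegralCurves

section Reparametrization

open Filter Topology

variable {J : Set ℝ}

theorem exists_hasDerivAt_of_continuousOn {E : Type*} [NormedAddCommGroup E] [NormedSpace ℝ E]
    [CompleteSpace E] {w : ℝ → E} (hJ : IsOpen J) (hJc : J.OrdConnected)
    (hw : ContinuousOn w J) : ∃ φ : ℝ → E, ∀ t ∈ J, HasDerivAt φ (w t) t := by
  rcases J.eq_empty_or_nonempty with rfl | ⟨t₀, ht₀⟩
  · exact ⟨0, by simp⟩
  exact ⟨fun t ↦ ∫ s in t₀..t, w s, fun t ht ↦ intervalIntegral.integral_hasDerivAt_right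
    (hw.mono (hJc.uIcc_subset ht₀ ht)).intervalIntegrable
    (hw.stronglyMeasurableAtFilter hJ t ht) (hw.continuousAt (hJ.mem_nhds ht))⟩

theorem exists_reparametrization {w : ℝ → ℝ} (hJ : IsOpen J) (hJc : J.OrdConnected)
    (hw : ContinuousOn w J) (hpos : ∀ t ∈ J, 0 < w t) :
    ∃ (φ ψ : ℝ → ℝ) (J' : Set ℝ), IsOpen J' ∧ J'.OrdConnected ∧ BijOn φ J J' ∧ InvOn ψ φ J J' ∧
      (∀ t ∈ J, HasDerivAt φ (w t) t) ∧ ∀ s ∈ J', HasDerivAt ψ (w (ψ s))⁻¹ s := by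
  obtain ⟨φ, hφ⟩ := exists_hasDerivAt_of_continuousOn hJ hJc hw
  have hstrict : ∀ t ∈ J, HasStrictDerivAt φ (w t) t := fun t ht ↦
    hasStrictDerivAt_of_hasDerivAt_of_continuousAt
      (eventually_of_mem (hJ.mem_nhds ht) hφ) (hw.continuousAt (hJ.mem_nhds ht))
  have hcont : ContinuousOn φ J := fun t ht ↦ (hφ t ht).continuousAt.continuousWithinAt
  have hmono : StrictMonoOn φ J := strictMonoOn_of_deriv_pos hJc.convex hcont fun t ht ↦ by
    rw [(hφ t (interior_subset ht)).deriv]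
    exact hpos t (interior_subset ht)
  have hbij : BijOn φ J (φ '' J) := hmono.injOn.bijOn_image
  have hinv : InvOn (Function.invFunOn φ J) φ J (φ '' J) := hbij.invOn_invFunOn
  refine ⟨φ, Function.invFunOn φ J, φ '' J, isOpen_iff_mem_nhds.2 ?_,
    (hJc.isPreconnected.image φ hcont).ordConnected, hbij, hinv, hφ, ?_⟩
  · rintro _ ⟨t, ht, rfl⟩
    rw [← (hstrict t ht).map_nhds_eq (hpos t ht).ne']
    exact image_mem_map (hJ.mem_nhds ht)
  · rintro _ ⟨t, ht, rfl⟩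
    rw [hinv.1 ht]
    exact ((hstrict t ht).to_local_left_inverse (hpos t ht).ne'
      (eventually_of_mem (hJ.mem_nhds ht) hinv.1)).hasDerivAt

end Reparametrization

section GeodesicFields

open Filter Topology

variable {E : Type*} [NormedAddCommGroup E] [NormedSpace ℝ E]

theorem fderiv_smul_fderiv_comm {F h : E → ℝ} {p : E} (hF : ContDiffAt ℝ 2 F p)
    (hh : DifferentiableAt ℝ h p) {r : ℝ} (hr : fderiv ℝ h p = r • fderiv ℝ F p) (u v : E) :
    fderiv ℝ (fun y ↦ h y • fderiv ℝ F y) p u v = fderiv ℝ (fun y ↦ h y • fderiv ℝ F y) p v u := by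
  have hdF : DifferentiableAt ℝ (fderiv ℝ F) p :=
    (hF.fderiv_right (m := 1) (by norm_num)).differentiableAt one_ne_zero
  have hsymm : fderiv ℝ (fderiv ℝ F) p u v = fderiv ℝ (fderiv ℝ F) p v u :=
    (hF.isSymmSndFDerivAt (by simp)).eq u v
  rw [fderiv_fun_smul hh hdF, hr]
  simp [hsymm]
  ring

/-- `∇_N N = N ⌟ dN♭ + grad |N|² / 2`, and both terms on the right vanish. -/
theorem lowered_acceleration_eq_zero {G : E → E →L[ℝ] E →L[ℝ] ℝ} {N : E → E} {p : E}
    (hG : DifferentiableAt ℝ G p) (hsymm : ∀ u v, G p u v = G p v u)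
    (hN : DifferentiableAt ℝ N p) (hunit : ∀ᶠ y in 𝓝 p, G y (N y) (N y) = 1)
    (hclosed : ∀ u v, fderiv ℝ (fun y ↦ G y (N y)) p u v = fderiv ℝ (fun y ↦ G y (N y)) p v u)
    (v : E) :
    G p (fderiv ℝ N p (N p)) v + fderiv ℝ G p (N p) (N p) v
      - (1 / 2 : ℝ) * fderiv ℝ G p v (N p) (N p) = 0 := by
  have hflat : HasFDerivAt (fun y ↦ G y (N y)) _ p := hG.hasFDerivAt.clm_apply hN.hasFDerivAt
  have hnorm := ((hflat.clm_apply hN.hasFDerivAt).congr_of_eventuallyEq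
    (hunit.mono fun y hy ↦ hy.symm)).unique (hasFDerivAt_const (1 : ℝ) p)
  have hnorm_v := congrArg (fun A ↦ A v) hnorm
  have hclosed_v := hclosed (N p) v
  rw [hflat.fderiv] at hclosed_v
  simp only [ContinuousLinearMap.flip_add, add_apply, ContinuousLinearMap.comp_apply,
    ContinuousLinearMap.flip_apply, zero_apply] at hnorm_v hclosed_v
  linarith [hsymm (N p) (fderiv ℝ N p v)]

end GeodesicFields

section Bilinear

theorem isInvertible_of_injective_toDual {E : Type*} [NormedAddCommGroup E] [NormedSpace ℝ E]
    [FiniteDimensional ℝ E] {B : E →L[ℝ] StrongDual ℝ E}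
    (hB : Function.Injective B) : B.IsInvertible := by
  have hfinrank : Module.finrank ℝ E = Module.finrank ℝ (StrongDual ℝ E) := by
    rw [← (LinearMap.toContinuousLinearMap (𝕜 := ℝ) (E := E) (F' := ℝ)).finrank_eq]
    exact Subspace.dual_finrank_eq.symm
  exact ⟨(B.toLinearMap.linearEquivOfInjective hB hfinrank).toContinuousLinearEquiv, rfl⟩

variable {ι : Type*} [Fintype ι] [DecidableEq ι] {F : Type*} [NormedAddCommGroup F]
  [NormedSpace ℝ F]

theorem bilinear_apply_eq_sum_single (B : EuclideanSpace ℝ ι →L[ℝ] EuclideanSpace ℝ ι →L[ℝ] F)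
    (u v : EuclideanSpace ℝ ι) :
    B u v = ∑ i, ∑ j, (u i * v j) • B (EuclideanSpace.single i 1) (EuclideanSpace.single j 1) := by
  have hsum (w : EuclideanSpace ℝ ι) : w = ∑ i, w i • EuclideanSpace.single i (1 : ℝ) := by
    simpa using ((EuclideanSpace.basisFun ι ℝ).sum_repr w).symm
  conv_lhs => rw [hsum u, hsum v]
  simp only [map_sum, map_smul, sum_apply, smul_apply, Finset.smul_sum, mul_smul]
  rw [Finset.sum_comm]
  exact Finset.sum_congr rfl fun i _ ↦ Finset.sum_congr rfl fun j _ ↦ smul_comm _ _ _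

end Bilinear

section Chart

variable {n : ℕ} {M : Type u} [TopologicalSpace M] [ChartedSpace (EuclideanSpace ℝ (Fin n)) M]

/-- The derivative of the inverse of the chart around `x₀` at the point with coordinates `y`. -/
noncomputable abbrev chartInvDeriv (x₀ : M) (y : EuclideanSpace ℝ (Fin n)) :
    EuclideanSpace ℝ (Fin n) →L[ℝ] TangentSpace (𝓡 n) ((extChartAt (𝓡 n) x₀).symm y) :=
  mfderiv (𝓡 n) (𝓡 n) (extChartAt (𝓡 n) x₀).symm y

/-- The derivative of the chart around `x₀` at the point with coordinates `y`. -/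
noncomputable abbrev chartDeriv (x₀ : M) (y : EuclideanSpace ℝ (Fin n)) :
    TangentSpace (𝓡 n) ((extChartAt (𝓡 n) x₀).symm y) →L[ℝ] EuclideanSpace ℝ (Fin n) :=
  mfderiv (𝓡 n) (𝓡 n) (extChartAt (𝓡 n) x₀) ((extChartAt (𝓡 n) x₀).symm y)

section

variable [IsManifold (𝓡 n) 1 M] {x₀ : M} {y : EuclideanSpace ℝ (Fin n)}
  (hy : y ∈ (extChartAt (𝓡 n) x₀).target)

include hy

theorem chartDeriv_chartInvDeriv (v : EuclideanSpace ℝ (Fin n)) :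
    chartDeriv x₀ y (chartInvDeriv x₀ y v) = v := by
  have hcomp := mfderiv_extChartAt_comp_mfderivWithin_extChartAt_symm (I := 𝓡 n) hy
  simp only [modelWithCornersSelf_coe, range_id, mfderivWithin_univ] at hcomp
  exact congrArg (fun A ↦ A v) hcomp

theorem chartInvDeriv_chartDeriv (v : TangentSpace (𝓡 n) ((extChartAt (𝓡 n) x₀).symm y)) :
    chartInvDeriv x₀ y (chartDeriv x₀ y v) = v := by
  have hcomp := mfderivWithin_extChartAt_symm_comp_mfderiv_extChartAt (I := 𝓡 n) hy
  simp only [modelWithCornersSelf_coe, range_id, mfderivWithin_univ] at hcomp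
  exact congrArg (fun A ↦ A v) hcomp

theorem chartInvDeriv_injective : Function.Injective (chartInvDeriv x₀ y) :=
  Function.LeftInverse.injective (chartDeriv_chartInvDeriv hy)

end

variable [RiemannianBundle (fun x : M ↦ TangentSpace (𝓡 n) x)]

/-- The Riemannian metric in the chart around `x₀`, as a field of bilinear forms on the model
space; its matrix is `metricMatrix`. -/
noncomputable def chartMetric (x₀ : M) (y : EuclideanSpace ℝ (Fin n)) :
    EuclideanSpace ℝ (Fin n) →L[ℝ] EuclideanSpace ℝ (Fin n) →L[ℝ] ℝ :=
  (innerSL ℝ).bilinearComp (chartInvDeriv x₀ y) (chartInvDeriv x₀ y)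

theorem chartMetric_apply (x₀ : M) (y u v : EuclideanSpace ℝ (Fin n)) :
    chartMetric x₀ y u v = ⟪chartInvDeriv x₀ y u, chartInvDeriv x₀ y v⟫_ℝ :=
  rfl

theorem chartMetric_symm (x₀ : M) (y u v : EuclideanSpace ℝ (Fin n)) :
    chartMetric x₀ y u v = chartMetric x₀ y v u :=
  real_inner_comm (chartInvDeriv x₀ y v) (chartInvDeriv x₀ y u)

theorem metricMatrix_apply (x₀ : M) (y : EuclideanSpace ℝ (Fin n)) (i j : Fin n) :
    metricMatrix n x₀ y i j =
      chartMetric x₀ y (EuclideanSpace.single i 1) (EuclideanSpace.single j 1) :=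
  rfl

section

variable [IsManifold (𝓡 n) 1 M] {x₀ : M} {y : EuclideanSpace ℝ (Fin n)}

theorem isInvertible_chartMetric (hy : y ∈ (extChartAt (𝓡 n) x₀).target) :
    (chartMetric x₀ y).IsInvertible := by
  refine isInvertible_of_injective_toDual ((injective_iff_map_eq_zero _).2 fun v hv ↦ ?_)
  have hself : ⟪chartInvDeriv x₀ y v, chartInvDeriv x₀ y v⟫_ℝ = 0 := by
    rw [← chartMetric_apply, hv, zero_apply]
  exact (map_eq_zero_iff _ (chartInvDeriv_injective hy)).1 (inner_self_eq_zero.1 hself)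

theorem isUnit_det_metricMatrix (hy : y ∈ (extChartAt (𝓡 n) x₀).target) :
    IsUnit (metricMatrix n x₀ y).det := by
  have hindep : LinearIndependent ℝ fun i ↦ coordVector n x₀ i y := by
    convert! (EuclideanSpace.basisFun (Fin n) ℝ).toBasis.linearIndependent.map'
      (chartInvDeriv x₀ y).toLinearMap (LinearMap.ker_eq_bot.2 (chartInvDeriv_injective hy))
      using 1
    funext i
    rw [Function.comp_apply, OrthonormalBasis.coe_toBasis, EuclideanSpace.basisFun_apply]
    rfl
  exact (Matrix.isUnit_iff_isUnit_det _).1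
    (Matrix.posDef_gram_of_linearIndependent hindep).isUnit

end

theorem contDiffOn_chartMetric [IsManifold (𝓡 n) 2 M]
    [IsContMDiffRiemannianBundle (𝓡 n) 1 (EuclideanSpace ℝ (Fin n))
      (fun x : M ↦ TangentSpace (𝓡 n) x)] (x₀ : M) :
    ContDiffOn ℝ 1 (chartMetric x₀) (extChartAt (𝓡 n) x₀).target := by
  have hopen : IsOpen (extChartAt (𝓡 n) x₀).target := isOpen_extChartAt_target x₀
  have hsection (v : EuclideanSpace ℝ (Fin n)) : ContMDiffOn (𝓡 n) (𝓡 n).tangent 1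
      (fun y ↦ (⟨(extChartAt (𝓡 n) x₀).symm y, chartInvDeriv x₀ y v⟩ : TangentBundle (𝓡 n) M))
      (extChartAt (𝓡 n) x₀).target := by
    have hchart : ContMDiffOn (𝓡 n) (𝓡 n) 2 (extChartAt (𝓡 n) x₀).symm
      (extChartAt (𝓡 n) x₀).target := contMDiffOn_extChartAt_symm x₀
    have hconst : ContMDiff (𝓡 n) (𝓡 n).tangent 1
        (fun y ↦ (⟨y, v⟩ : TangentBundle (𝓡 n) (EuclideanSpace ℝ (Fin n)))) := fun y ↦
      contMDiffAt_vectorSpace_iff_contDiffAt.2 contDiffAt_const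
    refine ((hchart.contMDiffOn_tangentMapWithin (m := 1) (by norm_num) hopen.uniqueMDiffOn).comp
      hconst.contMDiffOn fun y hy ↦ hy).congr fun y hy ↦ ?_
    simp only [Function.comp_apply, tangentMapWithin]
    rw [mfderivWithin_of_isOpen hopen hy]
    rfl
  exact contDiffOn_clm_apply.2 fun u ↦ contDiffOn_clm_apply.2 fun v ↦
    contMDiffOn_iff_contDiffOn.1 ((hsection u).inner_bundle (hsection v))

end Chart

section Christoffel

variable {n : ℕ} {M : Type u} [TopologicalSpace M] [ChartedSpace (EuclideanSpace ℝ (Fin n)) M]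
  [RiemannianBundle (fun x : M ↦ TangentSpace (𝓡 n) x)]
  {x₀ : M} {y : EuclideanSpace ℝ (Fin n)}

theorem metricPartial_eq_fderiv_chartMetric (hG : DifferentiableAt ℝ (chartMetric x₀) y)
    (l i j : Fin n) :
    metricPartial n x₀ l i j y = fderiv ℝ (chartMetric x₀) y (EuclideanSpace.single l 1)
      (EuclideanSpace.single i 1) (EuclideanSpace.single j 1) := by
  have hentry := (hG.hasFDerivAt.clm_apply (hasFDerivAt_const (EuclideanSpace.single i 1) y)
    ).clm_apply (hasFDerivAt_const (EuclideanSpace.single j 1) y)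
  simp [metricPartial, metricMatrix_apply, hentry.fderiv]

theorem sum_christoffel_mul_mul (hG : DifferentiableAt ℝ (chartMetric x₀) y) (k : Fin n)
    (v : EuclideanSpace ℝ (Fin n)) :
    ∑ i, ∑ j, christoffel n x₀ k i j y * v i * v j =
      ((metricMatrix n x₀ y)⁻¹.mulVec fun l ↦
        fderiv ℝ (chartMetric x₀) y v v (EuclideanSpace.single l 1)
          - (1 / 2 : ℝ) * fderiv ℝ (chartMetric x₀) y (EuclideanSpace.single l 1) v v) k := by
  have hfirst (l : Fin n) : fderiv ℝ (chartMetric x₀) y v v (EuclideanSpace.single l 1) =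
      ∑ i, ∑ j, v i * v j * metricPartial n x₀ i j l y := by
    rw [bilinear_apply_eq_sum_single _ v v]
    simp only [sum_apply, smul_apply, smul_eq_mul, metricPartial_eq_fderiv_chartMetric hG]
  have hlast (l : Fin n) : fderiv ℝ (chartMetric x₀) y (EuclideanSpace.single l 1) v v =
      ∑ i, ∑ j, v i * v j * metricPartial n x₀ l i j y := by
    rw [bilinear_apply_eq_sum_single]
    simp only [smul_eq_mul, metricPartial_eq_fderiv_chartMetric hG]
  have hswap (l : Fin n) : ∑ i, ∑ j, v i * v j * metricPartial n x₀ j i l y =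
      ∑ i, ∑ j, v i * v j * metricPartial n x₀ i j l y := by
    rw [Finset.sum_comm]
    exact Finset.sum_congr rfl fun i _ ↦ Finset.sum_congr rfl fun j _ ↦ by ring
  calc ∑ i, ∑ j, christoffel n x₀ k i j y * v i * v j
    _ = ∑ l, (metricMatrix n x₀ y)⁻¹ k l * ((1 / 2 : ℝ) *
          (∑ i, ∑ j, v i * v j * metricPartial n x₀ i j l y
            + ∑ i, ∑ j, v i * v j * metricPartial n x₀ j i l y
            - ∑ i, ∑ j, v i * v j * metricPartial n x₀ l i j y)) := by
      simp only [christoffel, Finset.mul_sum, Finset.sum_mul, ← Finset.sum_add_distrib,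
        ← Finset.sum_sub_distrib]
      rw [Finset.sum_comm_cycle]
      exact Finset.sum_congr rfl fun l _ ↦ Finset.sum_congr rfl fun i _ ↦
        Finset.sum_congr rfl fun j _ ↦ by ring
    _ = _ := by
      simp only [Matrix.mulVec, dotProduct, hfirst, hlast, hswap]
      exact Finset.sum_congr rfl fun l _ ↦ by ring

theorem add_sum_christoffel_eq_zero_of_lowered [IsManifold (𝓡 n) 1 M]
    (hy : y ∈ (extChartAt (𝓡 n) x₀).target) (hG : DifferentiableAt ℝ (chartMetric x₀) y)
    {a v : EuclideanSpace ℝ (Fin n)} (hlowered : ∀ u, chartMetric x₀ y a u +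
      fderiv ℝ (chartMetric x₀) y v v u - (1 / 2 : ℝ) * fderiv ℝ (chartMetric x₀) y u v v = 0)
    (k : Fin n) : a k + ∑ i, ∑ j, christoffel n x₀ k i j y * v i * v j = 0 := by
  have hmulVec : (metricMatrix n x₀ y).mulVec a = -fun l ↦
      (fderiv ℝ (chartMetric x₀) y v v (EuclideanSpace.single l 1)
        - (1 / 2 : ℝ) * fderiv ℝ (chartMetric x₀) y (EuclideanSpace.single l 1) v v) := by
    funext l
    have hl : chartMetric x₀ y a (EuclideanSpace.single l 1) =
        (metricMatrix n x₀ y).mulVec a l := by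
      rw [chartMetric_symm, bilinear_apply_eq_sum_single]
      simp [Matrix.mulVec, dotProduct, metricMatrix_apply, mul_comm]
    simp only [← hl, Pi.neg_apply]
    linarith [hlowered (EuclideanSpace.single l 1)]
  have hinv := congrArg (metricMatrix n x₀ y)⁻¹.mulVec hmulVec
  rw [Matrix.mulVec_mulVec, Matrix.nonsing_inv_mul _ (isUnit_det_metricMatrix hy),
    Matrix.one_mulVec, Matrix.mulVec_neg] at hinv
  rw [sum_christoffel_mul_mul hG, congrFun hinv k, Pi.neg_apply, neg_add_cancel]

end Christoffel

section IntegralCurvesOfUnitFields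

open Filter Topology

variable {n : ℕ} {M : Type u} [TopologicalSpace M] [ChartedSpace (EuclideanSpace ℝ (Fin n)) M]
  [RiemannianBundle (fun x : M ↦ TangentSpace (𝓡 n) x)]

theorem geodesic_equation_of_hasDerivAt [IsManifold (𝓡 n) 2 M]
    [IsContMDiffRiemannianBundle (𝓡 n) 1 (EuclideanSpace ℝ (Fin n))
      (fun x : M ↦ TangentSpace (𝓡 n) x)]
    {x₀ : M} {c : ℝ → M} {s : ℝ} {N : EuclideanSpace ℝ (Fin n) → EuclideanSpace ℝ (Fin n)}
    (hsource : c s ∈ (extChartAt (𝓡 n) x₀).source)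
    (hc : ∀ᶠ r in 𝓝 s, HasDerivAt (fun r ↦ extChartAt (𝓡 n) x₀ (c r))
      (N (extChartAt (𝓡 n) x₀ (c r))) r)
    (hN : DifferentiableAt ℝ N (extChartAt (𝓡 n) x₀ (c s)))
    (hunit : ∀ᶠ y in 𝓝 (extChartAt (𝓡 n) x₀ (c s)), chartMetric x₀ y (N y) (N y) = 1)
    (hclosed : ∀ u v,
      fderiv ℝ (fun y ↦ chartMetric x₀ y (N y)) (extChartAt (𝓡 n) x₀ (c s)) u v =
      fderiv ℝ (fun y ↦ chartMetric x₀ y (N y)) (extChartAt (𝓡 n) x₀ (c s)) v u) (k : Fin n) :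
    deriv (deriv (coords n x₀ c k)) s +
      ∑ i, ∑ j, christoffel n x₀ k i j (extChartAt (𝓡 n) x₀ (c s)) *
        deriv (coords n x₀ c i) s * deriv (coords n x₀ c j) s = 0 := by
  have hy := (extChartAt (𝓡 n) x₀).map_source hsource
  have hG : DifferentiableAt ℝ (chartMetric x₀) (extChartAt (𝓡 n) x₀ (c s)) :=
    ((contDiffOn_chartMetric x₀).contDiffAt
      ((isOpen_extChartAt_target x₀).mem_nhds hy)).differentiableAt one_ne_zero
  have hvelocity (i : Fin n) :
      deriv (coords n x₀ c i) =ᶠ[𝓝 s] fun r ↦ N (extChartAt (𝓡 n) x₀ (c r)) i :=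
    hc.mono fun r hr ↦ (hasDerivAt_coord hr i).deriv
  have hacceleration : deriv (deriv (coords n x₀ c k)) s =
      fderiv ℝ N (extChartAt (𝓡 n) x₀ (c s)) (N (extChartAt (𝓡 n) x₀ (c s))) k := by
    rw [(hvelocity k).deriv_eq]
    exact (hasDerivAt_coord (hN.hasFDerivAt.comp_hasDerivAt s hc.self_of_nhds) k).deriv
  rw [hacceleration]
  simp only [(hvelocity _).self_of_nhds]
  exact add_sum_christoffel_eq_zero_of_lowered hy hG
    (lowered_acceleration_eq_zero hG (chartMetric_symm x₀ _) hN hunit hclosed) k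

end IntegralCurvesOfUnitFields

section ChartGradient

open Filter Topology

variable {n : ℕ} {M : Type u} [TopologicalSpace M] [ChartedSpace (EuclideanSpace ℝ (Fin n)) M]

theorem contDiffOn_comp_extChartAt_symm {k : WithTop ℕ∞} [IsManifold (𝓡 n) k M] {f : M → ℝ}
    (hf : ContMDiff (𝓡 n) 𝓘(ℝ, ℝ) k f) (x₀ : M) :
    ContDiffOn ℝ k (f ∘ (extChartAt (𝓡 n) x₀).symm) (extChartAt (𝓡 n) x₀).target :=
  contMDiffOn_iff_contDiffOn.1 (hf.comp_contMDiffOn (contMDiffOn_extChartAt_symm x₀))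

variable [RiemannianBundle (fun x : M ↦ TangentSpace (𝓡 n) x)]

/-- The components of the gradient of `f` in the chart around `x₀`. -/
noncomputable def chartGradient (f : M → ℝ) (x₀ : M) (y : EuclideanSpace ℝ (Fin n)) :
    EuclideanSpace ℝ (Fin n) :=
  chartDeriv x₀ y (riemannianGradient n f ((extChartAt (𝓡 n) x₀).symm y))

/-- The components, in the chart around `x₀`, of the normalized gradient of `f`; its value at the
critical points of `f` is `0`. -/
noncomputable def chartUnitGradient (f : M → ℝ) (x₀ : M) (y : EuclideanSpace ℝ (Fin n)) :
    EuclideanSpace ℝ (Fin n) :=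
  ‖riemannianGradient n f ((extChartAt (𝓡 n) x₀).symm y)‖⁻¹ • chartGradient f x₀ y

theorem chartGradient_extChartAt (f : M → ℝ) {x₀ p : M} (hp : p ∈ (extChartAt (𝓡 n) x₀).source) :
    chartGradient f x₀ (extChartAt (𝓡 n) x₀ p) =
      mfderiv (𝓡 n) (𝓡 n) (extChartAt (𝓡 n) x₀) p (riemannianGradient n f p) :=
  congrArg (fun q ↦ (mfderiv (𝓡 n) (𝓡 n) (extChartAt (𝓡 n) x₀) q (riemannianGradient n f q) :
    EuclideanSpace ℝ (Fin n))) ((extChartAt (𝓡 n) x₀).left_inv hp)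

theorem inner_riemannianGradient (f : M → ℝ) (x : M) (v : TangentSpace (𝓡 n) x) :
    ⟪riemannianGradient n f x, v⟫_ℝ = mvfderiv (𝓡 n) f x v := by
  simp [riemannianGradient]

section

variable [IsManifold (𝓡 n) 1 M] {f : M → ℝ} {x₀ : M} {y : EuclideanSpace ℝ (Fin n)}
  (hy : y ∈ (extChartAt (𝓡 n) x₀).target)

include hy

theorem chartInvDeriv_chartGradient : chartInvDeriv x₀ y (chartGradient f x₀ y) =
    riemannianGradient n f ((extChartAt (𝓡 n) x₀).symm y) :=
  chartInvDeriv_chartDeriv hy _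

theorem chartMetric_chartGradient_self :
    chartMetric x₀ y (chartGradient f x₀ y) (chartGradient f x₀ y) =
      ‖riemannianGradient n f ((extChartAt (𝓡 n) x₀).symm y)‖ ^ 2 := by
  rw [chartMetric_apply, chartInvDeriv_chartGradient hy, real_inner_self_eq_norm_sq]

theorem chartMetric_chartUnitGradient_self
    (hregular : riemannianGradient n f ((extChartAt (𝓡 n) x₀).symm y) ≠ 0) :
    chartMetric x₀ y (chartUnitGradient f x₀ y) (chartUnitGradient f x₀ y) = 1 := by
  have hnorm := norm_ne_zero_iff.2 hregular
  simp only [chartUnitGradient, map_smul, smul_apply, smul_eq_mul,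
    chartMetric_chartGradient_self hy]
  field_simp

theorem chartMetric_chartGradient
    (hf : MDifferentiableAt (𝓡 n) 𝓘(ℝ, ℝ) f ((extChartAt (𝓡 n) x₀).symm y)) :
    chartMetric x₀ y (chartGradient f x₀ y) =
      fderiv ℝ (f ∘ (extChartAt (𝓡 n) x₀).symm) y := by
  have hchart : MDifferentiableAt (𝓡 n) (𝓡 n) (extChartAt (𝓡 n) x₀).symm y :=
    (mdifferentiableOn_extChartAt_symm y hy).mdifferentiableAt
      ((isOpen_extChartAt_target x₀).mem_nhds hy)
  ext v
  rw [chartMetric_apply, chartInvDeriv_chartGradient hy, inner_riemannianGradient,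
    ← mfderiv_eq_fderiv, mfderiv_comp y hf hchart]
  rfl

theorem fderiv_comp_extChartAt_symm_ne_zero
    (hf : MDifferentiableAt (𝓡 n) 𝓘(ℝ, ℝ) f ((extChartAt (𝓡 n) x₀).symm y))
    (hregular : riemannianGradient n f ((extChartAt (𝓡 n) x₀).symm y) ≠ 0) :
    fderiv ℝ (f ∘ (extChartAt (𝓡 n) x₀).symm) y ≠ 0 := by
  rw [← chartMetric_chartGradient hy hf]
  intro hzero
  have hnorm := chartMetric_chartGradient_self (f := f) hy
  rw [hzero, zero_apply] at hnorm
  exact hregular (norm_eq_zero.1 (pow_eq_zero_iff two_ne_zero |>.1 hnorm.symm))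

end

variable [IsManifold (𝓡 n) 2 M] [IsContMDiffRiemannianBundle (𝓡 n) 1 (EuclideanSpace ℝ (Fin n))
  (fun x : M ↦ TangentSpace (𝓡 n) x)] {f : M → ℝ} {x₀ : M} {y : EuclideanSpace ℝ (Fin n)}

theorem contDiffOn_chartGradient (hf : ContMDiff (𝓡 n) 𝓘(ℝ, ℝ) 2 f) (x₀ : M) :
    ContDiffOn ℝ 1 (chartGradient f x₀) (extChartAt (𝓡 n) x₀).target := by
  have hopen : IsOpen (extChartAt (𝓡 n) x₀).target := isOpen_extChartAt_target x₀
  have hdF := (contDiffOn_comp_extChartAt_symm hf x₀).fderiv_of_isOpen (m := 1) hopen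
    (by norm_num)
  have hinverse : ContDiffOn ℝ 1 (fun y ↦ (chartMetric x₀ y).inverse)
      (extChartAt (𝓡 n) x₀).target := fun y hy ↦
    (isInvertible_chartMetric hy).contDiffAt_map_inverse.comp_contDiffWithinAt y
      (contDiffOn_chartMetric x₀ y hy)
  refine (hinverse.clm_apply hdF).congr fun y hy ↦ ?_
  rw [← chartMetric_chartGradient hy (hf.mdifferentiable two_ne_zero _),
    (isInvertible_chartMetric hy).inverse_apply_self]

theorem contDiffAt_norm_riemannianGradient (hf : ContMDiff (𝓡 n) 𝓘(ℝ, ℝ) 2 f)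
    (hy : y ∈ (extChartAt (𝓡 n) x₀).target)
    (hregular : riemannianGradient n f ((extChartAt (𝓡 n) x₀).symm y) ≠ 0) :
    ContDiffAt ℝ 1 (fun z ↦ ‖riemannianGradient n f ((extChartAt (𝓡 n) x₀).symm z)‖) y := by
  have htarget := (isOpen_extChartAt_target x₀).mem_nhds hy
  have hX := contDiffOn_chartGradient hf x₀
  have hsq : ContDiffAt ℝ 1
      (fun z ↦ ‖riemannianGradient n f ((extChartAt (𝓡 n) x₀).symm z)‖ ^ 2) y :=
    ((((contDiffOn_chartMetric x₀).clm_apply hX).clm_apply hX).congr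
      fun z hz ↦ (chartMetric_chartGradient_self hz).symm).contDiffAt htarget
  simpa only [Real.sqrt_sq (norm_nonneg _)] using hsq.sqrt
    (pow_ne_zero 2 (norm_ne_zero_iff.2 hregular))

theorem contDiffAt_chartUnitGradient (hf : ContMDiff (𝓡 n) 𝓘(ℝ, ℝ) 2 f)
    (hy : y ∈ (extChartAt (𝓡 n) x₀).target)
    (hregular : riemannianGradient n f ((extChartAt (𝓡 n) x₀).symm y) ≠ 0) :
    ContDiffAt ℝ 1 (chartUnitGradient f x₀) y :=
  ((contDiffAt_norm_riemannianGradient hf hy hregular).inv (norm_ne_zero_iff.2 hregular)).smul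
    ((contDiffOn_chartGradient hf x₀).contDiffAt ((isOpen_extChartAt_target x₀).mem_nhds hy))

end ChartGradient

section MetricFunction

open Filter Topology

variable {n : ℕ} {M : Type u} [TopologicalSpace M] [ChartedSpace (EuclideanSpace ℝ (Fin n)) M]
  [RiemannianBundle (fun x : M ↦ TangentSpace (𝓡 n) x)] {f : M → ℝ} {x₀ : M}
  {y : EuclideanSpace ℝ (Fin n)}

namespace IsMetricFunction

theorem eventually_norm_gradient_eq [IsManifold (𝓡 n) 2 M] (hf : IsMetricFunction n f)
    (hy : y ∈ (extChartAt (𝓡 n) x₀).target)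
    (hregular : riemannianGradient n f ((extChartAt (𝓡 n) x₀).symm y) ≠ 0) :
    ∀ᶠ z in 𝓝 y,
      (f ∘ (extChartAt (𝓡 n) x₀).symm) z = (f ∘ (extChartAt (𝓡 n) x₀).symm) y →
      ‖riemannianGradient n f ((extChartAt (𝓡 n) x₀).symm z)‖ =
        ‖riemannianGradient n f ((extChartAt (𝓡 n) x₀).symm y)‖ := by
  have htarget := (isOpen_extChartAt_target x₀).mem_nhds hy
  have hF := ((contDiffOn_comp_extChartAt_symm hf.contMDiff x₀).contDiffAt
    htarget).hasStrictFDerivAt two_ne_zero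
  obtain ⟨V, hV, hVtarget, hlevel⟩ := exists_mem_nhds_isPreconnected_inter_level hF
    (fderiv_comp_extChartAt_symm_ne_zero hy (hf.contMDiff.mdifferentiable two_ne_zero _) hregular)
    htarget
  have himage := hlevel.image (extChartAt (𝓡 n) x₀).symm
    ((continuousOn_extChartAt_symm x₀).mono (inter_subset_left.trans hVtarget))
  have hcomponent := himage.subset_connectedComponentIn
    (mem_image_of_mem _ ⟨mem_of_mem_nhds hV, rfl⟩)
    (F := f ⁻¹' {f ((extChartAt (𝓡 n) x₀).symm y)}) (image_subset_iff.2 fun z hz ↦ hz.2)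
  filter_upwards [hV] with z hz hzlevel
  exact hf.norm_gradient_eq _ _ (hcomponent (mem_image_of_mem _ ⟨hz, hzlevel⟩))

variable [IsManifold (𝓡 n) 2 M] [IsContMDiffRiemannianBundle (𝓡 n) 1 (EuclideanSpace ℝ (Fin n))
  (fun x : M ↦ TangentSpace (𝓡 n) x)]

theorem exists_fderiv_inv_norm_gradient_eq (hf : IsMetricFunction n f)
    (hy : y ∈ (extChartAt (𝓡 n) x₀).target)
    (hregular : riemannianGradient n f ((extChartAt (𝓡 n) x₀).symm y) ≠ 0) :
    ∃ r : ℝ, fderiv ℝ (fun z ↦ ‖riemannianGradient n f ((extChartAt (𝓡 n) x₀).symm z)‖⁻¹) y =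
      r • fderiv ℝ (f ∘ (extChartAt (𝓡 n) x₀).symm) y :=
  exists_eq_smul_of_eventually_eq_on_level
    (((contDiffOn_comp_extChartAt_symm hf.contMDiff x₀).contDiffAt
      ((isOpen_extChartAt_target x₀).mem_nhds hy)).hasStrictFDerivAt two_ne_zero)
    (fderiv_comp_extChartAt_symm_ne_zero hy (hf.contMDiff.mdifferentiable two_ne_zero _) hregular)
    (((contDiffAt_norm_riemannianGradient hf.contMDiff hy hregular).inv
      (norm_ne_zero_iff.2 hregular)).hasStrictFDerivAt one_ne_zero)
    ((hf.eventually_norm_gradient_eq hy hregular).mono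
      fun _ hz hlevel ↦ congrArg (·⁻¹) (hz hlevel))

theorem fderiv_chartMetric_chartUnitGradient_comm (hf : IsMetricFunction n f)
    (hy : y ∈ (extChartAt (𝓡 n) x₀).target)
    (hregular : riemannianGradient n f ((extChartAt (𝓡 n) x₀).symm y) ≠ 0)
    (u v : EuclideanSpace ℝ (Fin n)) :
    fderiv ℝ (fun z ↦ chartMetric x₀ z (chartUnitGradient f x₀ z)) y u v =
      fderiv ℝ (fun z ↦ chartMetric x₀ z (chartUnitGradient f x₀ z)) y v u := by
  have htarget := (isOpen_extChartAt_target x₀).mem_nhds hy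
  have hdual : (fun z ↦ chartMetric x₀ z (chartUnitGradient f x₀ z)) =ᶠ[𝓝 y]
      fun z ↦ ‖riemannianGradient n f ((extChartAt (𝓡 n) x₀).symm z)‖⁻¹ •
        fderiv ℝ (f ∘ (extChartAt (𝓡 n) x₀).symm) z := by
    filter_upwards [htarget] with z hz
    rw [chartUnitGradient, map_smul,
      chartMetric_chartGradient hz (hf.contMDiff.mdifferentiable two_ne_zero _)]
  obtain ⟨r, hr⟩ := hf.exists_fderiv_inv_norm_gradient_eq hy hregular
  rw [hdual.fderiv_eq]
  exact fderiv_smul_fderiv_comm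
    ((contDiffOn_comp_extChartAt_symm hf.contMDiff x₀).contDiffAt htarget)
    (((contDiffAt_norm_riemannianGradient hf.contMDiff hy hregular).inv
      (norm_ne_zero_iff.2 hregular)).differentiableAt one_ne_zero) hr u v

end IsMetricFunction

end MetricFunction

section GradientLine

open Filter Topology

variable {n : ℕ} {M : Type u} [TopologicalSpace M] [ChartedSpace (EuclideanSpace ℝ (Fin n)) M]
  [RiemannianBundle (fun x : M ↦ TangentSpace (𝓡 n) x)] {f : M → ℝ} {γ : ℝ → M} {J : Set ℝ}

namespace IsGradientLineOn

theorem continuousAt (hγ : IsGradientLineOn n f γ J) {t : ℝ} (ht : t ∈ J) : ContinuousAt γ t :=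
  ((hγ.isMIntegralCurveOn t ht).hasMFDerivAt (hγ.isOpen.mem_nhds ht)).continuousAt

theorem isOpen_inter_preimage_source (hγ : IsGradientLineOn n f γ J) (x₀ : M) :
    IsOpen (J ∩ γ ⁻¹' (extChartAt (𝓡 n) x₀).source) :=
  ContinuousOn.isOpen_inter_preimage (fun _ ht ↦ (hγ.continuousAt ht).continuousWithinAt)
    hγ.isOpen (isOpen_extChartAt_source x₀)

theorem hasDerivAt_extChartAt [IsManifold (𝓡 n) 1 M] (hγ : IsGradientLineOn n f γ J) {x₀ : M}
    {t : ℝ} (ht : t ∈ J ∩ γ ⁻¹' (extChartAt (𝓡 n) x₀).source) :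
    HasDerivAt (fun t ↦ extChartAt (𝓡 n) x₀ (γ t))
      (chartGradient f x₀ (extChartAt (𝓡 n) x₀ (γ t))) t := by
  have hvelocity := (hγ.isMIntegralCurveOn t ht.1).hasMFDerivAt (hγ.isOpen.mem_nhds ht.1)
  have hchart : MDifferentiableAt (𝓡 n) (𝓡 n) (extChartAt (𝓡 n) x₀) (γ t) :=
    mdifferentiableAt_extChartAt (by simpa using ht.2)
  let A : TangentSpace (𝓡 n) (γ t) →L[ℝ] EuclideanSpace ℝ (Fin n) :=
    mfderiv (𝓡 n) (𝓡 n) (extChartAt (𝓡 n) x₀) (γ t)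
  let L : ℝ →L[ℝ] EuclideanSpace ℝ (Fin n) :=
    A.comp ((1 : ℝ →L[ℝ] ℝ).smulRight (riemannianGradient n f (γ t)))
  have hcomp : HasFDerivAt (fun t ↦ extChartAt (𝓡 n) x₀ (γ t)) L t :=
    (hchart.hasMFDerivAt.comp t hvelocity).hasFDerivAt
  have hL : L 1 = A (riemannianGradient n f (γ t)) := congrArg A (one_smul ℝ _)
  rw [chartGradient_extChartAt f ht.2]
  exact hL ▸ hcomp.hasDerivAt

variable [IsManifold (𝓡 n) 2 M] [IsContMDiffRiemannianBundle (𝓡 n) 1 (EuclideanSpace ℝ (Fin n))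
  (fun x : M ↦ TangentSpace (𝓡 n) x)]

theorem contDiffOn_extChartAt (hγ : IsGradientLineOn n f γ J)
    (hf : ContMDiff (𝓡 n) 𝓘(ℝ, ℝ) 2 f) (x₀ : M) :
    ContDiffOn ℝ 2 (fun t ↦ extChartAt (𝓡 n) x₀ (γ t))
      (J ∩ γ ⁻¹' (extChartAt (𝓡 n) x₀).source) := by
  simpa only [Nat.cast_one, one_add_one_eq_two] using
    contDiffOn_succ_of_hasDerivAt (m := 1) (hγ.isOpen_inter_preimage_source x₀)
      (by simpa only [Nat.cast_one] using contDiffOn_chartGradient hf x₀)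
      (fun t ht ↦ (extChartAt (𝓡 n) x₀).map_source ht.2) fun t ht ↦ hγ.hasDerivAt_extChartAt ht

theorem contMDiffOn (hγ : IsGradientLineOn n f γ J) (hf : ContMDiff (𝓡 n) 𝓘(ℝ, ℝ) 2 f) :
    ContMDiffOn 𝓘(ℝ, ℝ) (𝓡 n) 2 γ J := by
  intro t ht
  refine ContMDiffAt.contMDiffWithinAt (contMDiffAt_iff_target.2 ⟨hγ.continuousAt ht, ?_⟩)
  exact ((hγ.contDiffOn_extChartAt hf (γ t)).contDiffAt
    ((hγ.isOpen_inter_preimage_source (γ t)).mem_nhds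
      ⟨ht, mem_extChartAt_source (γ t)⟩)).contMDiffAt

theorem contDiffAt_norm_gradient (hγ : IsGradientLineOn n f γ J)
    (hf : ContMDiff (𝓡 n) 𝓘(ℝ, ℝ) 2 f) {t : ℝ} (ht : t ∈ J)
    (hregular : riemannianGradient n f (γ t) ≠ 0) :
    ContDiffAt ℝ 1 (fun s ↦ ‖riemannianGradient n f (γ s)‖) t := by
  have hsource := mem_extChartAt_source (I := 𝓡 n) (γ t)
  have hleft := (extChartAt (𝓡 n) (γ t)).left_inv hsource
  have hV := (hγ.isOpen_inter_preimage_source (γ t)).mem_nhds ⟨ht, hsource⟩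
  have hcomp := (contDiffAt_norm_riemannianGradient hf
    ((extChartAt (𝓡 n) (γ t)).map_source hsource) (by rwa [hleft])).comp t
    (((hγ.contDiffOn_extChartAt hf (γ t)).contDiffAt hV).of_le one_le_two)
  refine hcomp.congr_of_eventuallyEq ?_
  filter_upwards [hV] with s hs
  rw [Function.comp_apply, (extChartAt (𝓡 n) (γ t)).left_inv hs.2]

theorem eventually_eq_of_gradient_eq_zero (hγ : IsGradientLineOn n f γ J)
    (hf : ContMDiff (𝓡 n) 𝓘(ℝ, ℝ) 2 f) {t₀ : ℝ} (ht₀ : t₀ ∈ J)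
    (hcritical : riemannianGradient n f (γ t₀) = 0) : ∀ᶠ t in 𝓝 t₀, γ t = γ t₀ := by
  have hsource := mem_extChartAt_source (I := 𝓡 n) (γ t₀)
  have hV := (hγ.isOpen_inter_preimage_source (γ t₀)).mem_nhds ⟨ht₀, hsource⟩
  have hconst := eventually_eq_of_hasDerivAt_of_eq_zero
    (x := fun t ↦ extChartAt (𝓡 n) (γ t₀) (γ t))
    ((contDiffOn_chartGradient hf (γ t₀)).contDiffAt ((isOpen_extChartAt_target _).mem_nhds
      ((extChartAt (𝓡 n) (γ t₀)).map_source hsource)))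
    (eventually_of_mem hV fun t ht ↦ hγ.hasDerivAt_extChartAt ht)
    (by rw [chartGradient_extChartAt f hsource, hcritical]; exact map_zero _)
  filter_upwards [hconst, hV] with t ht htV
  exact (extChartAt (𝓡 n) (γ t₀)).injOn htV.2 hsource ht

theorem gradient_eq_zero_or_ne_zero (hγ : IsGradientLineOn n f γ J)
    (hf : ContMDiff (𝓡 n) 𝓘(ℝ, ℝ) 2 f) :
    (∀ t ∈ J, riemannianGradient n f (γ t) = 0) ∨
      ∀ t ∈ J, riemannianGradient n f (γ t) ≠ 0 := by
  have hcritical : IsOpen {t ∈ J | riemannianGradient n f (γ t) = 0} := by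
    refine isOpen_iff_mem_nhds.2 fun t ⟨ht, hzero⟩ ↦ ?_
    filter_upwards [hγ.isOpen.mem_nhds ht, hγ.eventually_eq_of_gradient_eq_zero hf ht hzero]
      with s hs hst
    exact ⟨hs, by rw [hst, hzero]⟩
  have hregular : IsOpen {t ∈ J | riemannianGradient n f (γ t) ≠ 0} := by
    refine isOpen_iff_mem_nhds.2 fun t ⟨ht, hne⟩ ↦ ?_
    filter_upwards [hγ.isOpen.mem_nhds ht, (hγ.contDiffAt_norm_gradient hf ht
      hne).continuousAt.eventually_ne (norm_ne_zero_iff.2 hne)] with s hs hnorm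
    exact ⟨hs, norm_ne_zero_iff.1 hnorm⟩
  have hdisjoint : Disjoint {t ∈ J | riemannianGradient n f (γ t) = 0}
      {t ∈ J | riemannianGradient n f (γ t) ≠ 0} :=
    disjoint_left.2 fun t hzero hne ↦ hne.2 hzero.2
  refine (hγ.ordConnected.isPreconnected.subset_or_subset hcritical hregular hdisjoint
    fun t ht ↦ ?_).imp (fun h t ht ↦ (h ht).2) fun h t ht ↦ (h ht).2
  exact (em (riemannianGradient n f (γ t) = 0)).imp (And.intro ht) (And.intro ht)

end IsGradientLineOn

end GradientLine

section Geodesic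

open Filter Topology

variable {n : ℕ} {M : Type u} [TopologicalSpace M] [ChartedSpace (EuclideanSpace ℝ (Fin n)) M]
  [RiemannianBundle (fun x : M ↦ TangentSpace (𝓡 n) x)] {f : M → ℝ} {c γ : ℝ → M} {J : Set ℝ}

theorem isGeodesicOn_of_locally_constant (hJ : IsOpen J) (hJc : J.OrdConnected)
    (hc : ∀ t ∈ J, ∀ᶠ s in 𝓝 t, c s = c t) : IsGeodesicOn n c J where
  isOpen := hJ
  ordConnected := hJc
  contMDiffOn t ht := (contMDiffAt_const.congr_of_eventuallyEq (hc t ht)).contMDiffWithinAt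
  geodesic_eq x₀ t ht _ k := by
    have hderiv (i : Fin n) : deriv (coords n x₀ c i) =ᶠ[𝓝 t] fun _ ↦ 0 := by
      have hcoords : coords n x₀ c i =ᶠ[𝓝 t] fun _ ↦ coords n x₀ c i t :=
        (hc t ht).mono fun s hs ↦ by simp only [coords, hs]
      simpa only [deriv_const'] using hcoords.deriv
    simp [(hderiv _).deriv_eq, (hderiv _).self_of_nhds]

variable [IsManifold (𝓡 n) 2 M] [IsContMDiffRiemannianBundle (𝓡 n) 1 (EuclideanSpace ℝ (Fin n))
  (fun x : M ↦ TangentSpace (𝓡 n) x)]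

theorem IsMetricFunction.isGeodesicOn_of_hasDerivAt (hf : IsMetricFunction n f) (hJ : IsOpen J)
    (hJc : J.OrdConnected) (hc : ContMDiffOn 𝓘(ℝ, ℝ) (𝓡 n) 2 c J)
    (hregular : ∀ s ∈ J, riemannianGradient n f (c s) ≠ 0)
    (hcN : ∀ x₀, ∀ s ∈ J, c s ∈ (extChartAt (𝓡 n) x₀).source →
      HasDerivAt (fun s ↦ extChartAt (𝓡 n) x₀ (c s))
        (chartUnitGradient f x₀ (extChartAt (𝓡 n) x₀ (c s))) s) :
    IsGeodesicOn n c J where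
  isOpen := hJ
  ordConnected := hJc
  contMDiffOn := hc
  geodesic_eq x₀ s hs hsource := by
    have hy := (extChartAt (𝓡 n) x₀).map_source hsource
    have hy_regular :
        riemannianGradient n f ((extChartAt (𝓡 n) x₀).symm (extChartAt (𝓡 n) x₀ (c s))) ≠ 0 := by
      rw [(extChartAt (𝓡 n) x₀).left_inv hsource]
      exact hregular s hs
    have hnear : J ∩ c ⁻¹' (extChartAt (𝓡 n) x₀).source ∈ 𝓝 s :=
      (hc.continuousOn.isOpen_inter_preimage hJ (isOpen_extChartAt_source x₀)).mem_nhds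
        ⟨hs, hsource⟩
    refine geodesic_equation_of_hasDerivAt hsource
      (eventually_of_mem hnear fun r hr ↦ hcN x₀ r hr.1 hr.2)
      ((contDiffAt_chartUnitGradient hf.contMDiff hy hy_regular).differentiableAt one_ne_zero) ?_
      (hf.fderiv_chartMetric_chartUnitGradient_comm hy hy_regular)
    filter_upwards [(isOpen_extChartAt_target x₀).mem_nhds hy,
      (contDiffAt_norm_riemannianGradient hf.contMDiff hy hy_regular).continuousAt.eventually_ne
        (norm_ne_zero_iff.2 hy_regular)] with z hz hnorm
    exact chartMetric_chartUnitGradient_self hz (norm_ne_zero_iff.1 hnorm)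

namespace IsGradientLineOn

theorem isGeodesicOn_comp (hγ : IsGradientLineOn n f γ J) (hf : IsMetricFunction n f)
    {ψ : ℝ → ℝ} {J' : Set ℝ} (hJ' : IsOpen J') (hJ'c : J'.OrdConnected) (hψJ : MapsTo ψ J' J)
    (hψ : ∀ s ∈ J', HasDerivAt ψ ‖riemannianGradient n f (γ (ψ s))‖⁻¹ s)
    (hregular : ∀ t ∈ J, riemannianGradient n f (γ t) ≠ 0) : IsGeodesicOn n (γ ∘ ψ) J' := by
  have hψ_contDiff : ContDiffOn ℝ 2 ψ J' := by
    have hspeed : ContDiffOn ℝ (1 : ℕ) (fun t ↦ ‖riemannianGradient n f (γ t)‖⁻¹) J :=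
      fun t ht ↦ ((hγ.contDiffAt_norm_gradient hf.contMDiff ht (hregular t ht)).inv
        (norm_ne_zero_iff.2 (hregular t ht))).contDiffWithinAt
    simpa only [Nat.cast_one, one_add_one_eq_two] using
      contDiffOn_succ_of_hasDerivAt hJ' hspeed hψJ hψ
  refine hf.isGeodesicOn_of_hasDerivAt hJ' hJ'c
    ((hγ.contMDiffOn hf.contMDiff).comp hψ_contDiff.contMDiffOn hψJ)
    (fun s hs ↦ hregular _ (hψJ hs)) fun x₀ s hs hsource ↦ ?_
  rw [chartUnitGradient, (extChartAt (𝓡 n) x₀).left_inv hsource]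
  exact (hγ.hasDerivAt_extChartAt ⟨hψJ hs, hsource⟩).scomp s (hψ s hs)

theorem isGeodesicLineOn (hγ : IsGradientLineOn n f γ J) (hf : IsMetricFunction n f) :
    IsGeodesicLineOn n γ J := by
  rcases hγ.gradient_eq_zero_or_ne_zero hf.contMDiff with hcritical | hregular
  · exact ⟨γ, J, id, isGeodesicOn_of_locally_constant hγ.isOpen hγ.ordConnected fun t ht ↦
      hγ.eventually_eq_of_gradient_eq_zero hf.contMDiff ht (hcritical t ht), contDiffOn_id,
      by simp, bijOn_id J, fun _ _ ↦ rfl⟩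
  have hpos : ∀ t ∈ J, 0 < ‖riemannianGradient n f (γ t)‖ := fun t ht ↦
    norm_pos_iff.2 (hregular t ht)
  have hspeed : ContDiffOn ℝ 1 (fun t ↦ ‖riemannianGradient n f (γ t)‖) J := fun t ht ↦
    (hγ.contDiffAt_norm_gradient hf.contMDiff ht (hregular t ht)).contDiffWithinAt
  obtain ⟨φ, ψ, J', hJ', hJ'c, hbij, hinv, hφ, hψ⟩ :=
    exists_reparametrization hγ.isOpen hγ.ordConnected hspeed.continuousOn hpos
  have hφ_contDiff : ContDiffOn ℝ 2 φ J := by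
    rw [← one_add_one_eq_two, contDiffOn_succ_iff_deriv_of_isOpen hγ.isOpen]
    exact ⟨fun t ht ↦ (hφ t ht).differentiableAt.differentiableWithinAt, by simp,
      hspeed.congr fun t ht ↦ (hφ t ht).deriv⟩
  refine ⟨γ ∘ ψ, J', φ, hγ.isGeodesicOn_comp hf hJ' hJ'c (hinv.1.mapsTo hbij.surjOn) hψ hregular,
    hφ_contDiff, fun t ht ↦ ?_, hbij, fun t ht ↦ ?_⟩
  · rw [(hφ t ht).deriv]
    exact hpos t ht
  · rw [Function.comp_apply, hinv.1 ht]

end IsGradientLineOn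

end Geodesic

section Euclidean

open Filter Topology

variable {n : ℕ}

theorem metricMatrix_euclideanSpace (x₀ y : EuclideanSpace ℝ (Fin n)) :
    metricMatrix n x₀ y = 1 := by
  have hcoordVector (l : Fin n) : (coordVector n x₀ l y : EuclideanSpace ℝ (Fin n)) =
      EuclideanSpace.single l (1 : ℝ) := by
    have hid := (hasMFDerivAt_id (I := 𝓡 n) y).congr_of_eventuallyEq
      (f₁ := (extChartAt (𝓡 n) x₀).symm) (Eventually.of_forall fun _ ↦ rfl)
    exact congrArg (fun A : EuclideanSpace ℝ (Fin n) →L[ℝ] EuclideanSpace ℝ (Fin n) ↦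
      A (EuclideanSpace.single l (1 : ℝ))) hid.mfderiv
  ext i j
  calc metricMatrix n x₀ y i j
    _ = ⟪(EuclideanSpace.single i 1 : EuclideanSpace ℝ (Fin n)), EuclideanSpace.single j 1⟫_ℝ := by
      rw [← hcoordVector i, ← hcoordVector j]
      rfl
    _ = (1 : Matrix (Fin n) (Fin n) ℝ) i j := by
      rw [Matrix.one_apply]
      exact orthonormal_iff_ite.1 (EuclideanSpace.orthonormal_single (𝕜 := ℝ)) i j

theorem christoffel_euclideanSpace (x₀ : EuclideanSpace ℝ (Fin n)) (k i j : Fin n)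
    (y : EuclideanSpace ℝ (Fin n)) : christoffel n x₀ k i j y = 0 := by
  simp [christoffel, metricPartial, metricMatrix_euclideanSpace]

theorem euclideanCurvature_eq_zero_of_deriv_eq_smul {γ : ℝ → EuclideanSpace ℝ (Fin n)}
    {μ : ℝ → ℝ} {v : EuclideanSpace ℝ (Fin n)} {t : ℝ}
    (hγ : ∀ᶠ s in 𝓝 t, 0 < μ s ∧ deriv γ s = μ s • v) : euclideanCurvature γ t = 0 := by
  have htangent : (fun s ↦ ‖deriv γ s‖⁻¹ • deriv γ s) =ᶠ[𝓝 t] fun _ ↦ ‖v‖⁻¹ • v := by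
    filter_upwards [hγ] with s ⟨hμ, hs⟩
    rw [hs, norm_smul, Real.norm_of_nonneg hμ.le, smul_smul, mul_inv, mul_right_comm,
      inv_mul_cancel₀ hμ.ne', one_mul]
  rw [euclideanCurvature, htangent.deriv_eq, deriv_const, norm_zero, zero_div]

theorem IsGeodesicOn.exists_hasDerivAt_const {c : ℝ → EuclideanSpace ℝ (Fin n)} {J : Set ℝ}
    (hc : IsGeodesicOn n c J) : ∃ v, ∀ s ∈ J, HasDerivAt c v s := by
  have hc2 : ContDiffOn ℝ 2 c J := contMDiffOn_iff_contDiffOn.1 hc.contMDiffOn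
  have hdc : DifferentiableOn ℝ (deriv c) J :=
    (hc2.deriv_of_isOpen (m := 1) hc.isOpen (by norm_num)).differentiableOn one_ne_zero
  have hvelocity : ∀ s ∈ J, HasDerivAt c (deriv c s) s := fun s hs ↦
    ((hc2.contDiffAt (hc.isOpen.mem_nhds hs)).differentiableAt two_ne_zero).hasDerivAt
  have hacceleration : EqOn (deriv (deriv c)) 0 J := fun s hs ↦ by
    ext k
    change deriv (deriv c) s k = 0
    have hk := hc.geodesic_eq (c s) s hs (mem_extChartAt_source _) k
    have hcoords : deriv (coords n (c s) c k) =ᶠ[𝓝 s] fun s ↦ deriv c s k :=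
      eventually_of_mem (hc.isOpen.mem_nhds hs) fun r hr ↦
        (hasDerivAt_coord (hvelocity r hr) k).deriv
    have hddc := (hdc.differentiableAt (hc.isOpen.mem_nhds hs)).hasDerivAt
    simpa only [christoffel_euclideanSpace, zero_mul, Finset.sum_const_zero, add_zero,
      hcoords.deriv_eq, (hasDerivAt_coord hddc k).deriv] using hk
  obtain ⟨v, hv⟩ := hc.isOpen.exists_is_const_of_deriv_eq_zero hc.ordConnected.isPreconnected
    hdc hacceleration
  exact ⟨v, fun s hs ↦ hv s hs ▸ hvelocity s hs⟩

theorem IsGeodesicLineOn.euclideanCurvature_eq_zero {γ : ℝ → EuclideanSpace ℝ (Fin n)} {J : Set ℝ}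
    (hγ : IsGeodesicLineOn n γ J) (hJ : IsOpen J) {t : ℝ} (ht : t ∈ J) :
    euclideanCurvature γ t = 0 := by
  obtain ⟨c, J', φ, hc, hφ, hφ_pos, hbij, hγc⟩ := hγ
  obtain ⟨v, hv⟩ := hc.exists_hasDerivAt_const
  refine euclideanCurvature_eq_zero_of_deriv_eq_smul (μ := deriv φ) (v := v)
    (eventually_of_mem (hJ.mem_nhds ht) fun s hs ↦ ⟨hφ_pos s hs, ?_⟩)
  have hφs := ((hφ.contDiffAt (hJ.mem_nhds hs)).differentiableAt two_ne_zero).hasDerivAt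
  have hcomp : γ =ᶠ[𝓝 s] c ∘ φ := eventually_of_mem (hJ.mem_nhds hs) hγc
  rw [hcomp.deriv_eq, ((hv _ (hbij.mapsTo hs)).scomp s hφs).deriv]

end Euclidean

theorem mainTheorem2_general (n : ℕ) :
    (∀ (M : Type u) [TopologicalSpace M] [ChartedSpace (EuclideanSpace ℝ (Fin n)) M]
      [IsManifold (𝓡 n) 2 M] [RiemannianBundle (fun x : M ↦ TangentSpace (𝓡 n) x)]
      [IsContMDiffRiemannianBundle (𝓡 n) 1 (EuclideanSpace ℝ (Fin n))
        (fun x : M ↦ TangentSpace (𝓡 n) x)]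
      (f : M → ℝ), IsMetricFunction n f →
      ∀ (γ : ℝ → M) (J : Set ℝ), IsGradientLineOn n f γ J → IsGeodesicLineOn n γ J) ∧
    (∀ f : EuclideanSpace ℝ (Fin n) → ℝ, IsMetricFunction n f →
      ∀ (γ : ℝ → EuclideanSpace ℝ (Fin n)) (J : Set ℝ), IsGradientLineOn n f γ J →
        ∀ t ∈ J, euclideanCurvature γ t = 0) :=
  ⟨fun _ _ _ _ _ _ _ hf _ _ hγ ↦ hγ.isGeodesicLineOn hf,
    fun _ hf _ _ hγ _ ht ↦ (hγ.isGeodesicLineOn hf).euclideanCurvature_eq_zero hγ.isOpen ht⟩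

theorem mainTheorem2 (n : ℕ) :
    (∀ (M : Type u) [TopologicalSpace M] [ChartedSpace (EuclideanSpace ℝ (Fin n)) M]
      [IsManifold (𝓡 n) ∞ M] [RiemannianBundle (fun x : M ↦ TangentSpace (𝓡 n) x)]
      [IsContMDiffRiemannianBundle (𝓡 n) ∞ (EuclideanSpace ℝ (Fin n))
        (fun x : M ↦ TangentSpace (𝓡 n) x)]
      (f : M → ℝ), IsMetricFunction n f →
      ∀ (γ : ℝ → M) (J : Set ℝ), IsGradientLineOn n f γ J → IsGeodesicLineOn n γ J) ∧
    (∀ f : EuclideanSpace ℝ (Fin n) → ℝ, IsMetricFunction n f →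
      ∀ (γ : ℝ → EuclideanSpace ℝ (Fin n)) (J : Set ℝ), IsGradientLineOn n f γ J →
        ∀ t ∈ J, euclideanCurvature γ t = 0) :=
  ⟨fun M _ _ _ _ _ ↦
    haveI : IsManifold (𝓡 n) 2 M := .of_le (n := ∞) ENat.LEInfty.out
    haveI : IsContMDiffRiemannianBundle (𝓡 n) 1 (EuclideanSpace ℝ (Fin n))
      (fun x : M ↦ TangentSpace (𝓡 n) x) := .of_le (n := ∞) (by norm_num)
    (mainTheorem2_general n).1 M, (mainTheorem2_general.{u} n).2⟩
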